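/- Let $G,H$ be separable real Hilbert spaces, $(\Omega,\mathcal F,P)$ a probability space, and $L^0_P(\Omega,\mathbb R)$ the space of classes of real random variables with the topology of convergence in probability. A cylindrical random variable in $G$ is a continuous linear map $X\colon G\to L^0_P(\Omega,\mathbb R)$. A cylindrical Lévy process in $G$ is a family $L=(L(t))_{t\ge0}$ of cylindrical random variables such that for all $g_1,\dots,g_m\in G$ the process $(L(t)g_1,\dots,L(t)g_m)_{t\ge 0}$ is a Lévy process in $\mathbb R^m$ (it starts at $0$ almost surely, has independent and stationary increments, and is stochastically continuous). For a Hilbert–Schmidt operator $\Phi\in L_2(G,H)$ and a cylindrical random variable $X$, an $H$-valued random variable, written $\Phi X$, with $\langle \Phi X,h\rangle=X(\Phi^*h)$ a.s. for each $h\in H$ is called a Radonification of $X$ by $\Phi$. Let $L$ be a cylindrical Lévy process in $G$ and define $\widetilde L(t)\colon G\to L^0_{P\otimes P}(\Omega\times\Omega,\mathbb R)$ by $(\widetilde L(t)g)(\omega,\omega')=(L(t)g)(\omega')$. (a) $\widetilde L=(\widetilde L(t))_{t\ge 0}$ is a cylindrical Lévy process in $G$ on $(\Omega\times\Omega,\mathcal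 F\otimes\mathcal F,P\otimes P)$. (b) Let $(\mathcal F_t)_{t\ge0}$ be the filtration generated by $L$ (where the class $L(s)g$ generates the $\sigma$-algebra generated by all its measurable representatives) or, more generally, any filtration such that each $L(t)g$ has an $\mathcal F_t$-measurable representative and $(L(t)g_1-L(s)g_1,\dots,L(t)g_m-L(s)g_m)$ is independent of $\mathcal F_s$ for all $s\le t$ and $g_1,\dots,g_m\in G$; the generated filtration has these two properties. Let $0=t_0\le t_1\le\dots\le t_N=T$ and, for $n=1,\dots,N$, let $\Theta_n=\sum_{k=1}^{M(n)}\Phi_{n,k}\mathbb 1_{A_{n,k}}$ with $\Phi_{n,k}\in L_2(G,H)$ and $A_{n,k}\in\mathcal F_{t_{n-1}}$. Then there exist $\mathcal F_{t_n}$-measurable Radonifications $\Phi_{n,k}(L(t_n)-L(t_{n-1}))$ on $\Omega$, and $\mathcal F_{t_n}\otimes\mathcal F_{t_n}$-measurable Radonifications $\Phi_{n,k}(\widetilde L(t_n)-\widetilde L(t_{n-1}))$ on $\Omega\times\Omega$ whose section at every $\omega\in\Omega$ is a Radonification of $L(t_n)-L(t_{n-1})$ by $\Phi_{n,k}$. For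 any choice of such versions put \[X_n=\sum_{k=1}^{M(n)}\mathbb 1_{A_{n,k}}\,\Phi_{n,k}\big(L(t_n)-L(t_{n-1})\big),\qquad Y_n(\omega,\omega')=\sum_{k=1}^{M(n)}\mathbb 1_{A_{n,k}}(\omega)\,\big(\Phi_{n,k}(\widetilde L(t_n)-\widetilde L(t_{n-1}))\big)(\omega,\omega').\] Then $(Y_n)_{n=1}^N$ on $(\Omega\times\Omega,\mathcal F\otimes\mathcal F,P\otimes P,(\mathcal F_{t_n}\otimes\mathcal F_{t_n})_{n=0}^N)$ is a decoupled tangent sequence to $(X_n)_{n=1}^N$ on $(\Omega,\mathcal F,P,(\mathcal F_{t_n})_{n=0}^N)$; that is, $X_n$ is $\mathcal F_{t_n}$-measurable and $Y_n$ is $\mathcal F_{t_n}\otimes\mathcal F_{t_n}$-measurable for each $n$; for every $\omega\in\Omega$ the random variables $Y_1(\omega,\cdot),\dots,Y_N(\omega,\cdot)$ are independent under $P$; and for each $n$, with $X_n(\omega,\omega'):=X_n(\omega)$, the regular conditional laws satisfy \[\mathcal L\big(X_n\mid\mathcal F_{t_{n-1}}\otimes\mathcal F_{t_{n-1}}\big)=\mathcal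 L\big(Y_n\mid\mathcal F_{t_{n-1}}\otimes\mathcal F_{t_{n-1}}\big)\qquad P\otimes P\text{-a.s.}\] -/

import Mathlib

open MeasureTheory ProbabilityTheory Filter Topology
open scoped NNReal

noncomputable section

namespace CylLevy

section General

variable {Ω Ω' : Type*} [mΩ : MeasurableSpace Ω] [mΩ' : MeasurableSpace Ω']
variable {G H : Type*}
  [NormedAddCommGroup G] [InnerProductSpace ℝ G] [CompleteSpace G]
  [NormedAddCommGroup H] [InnerProductSpace ℝ H] [CompleteSpace H]

/-- A bounded operator `Φ : G → H` is Hilbert-Schmidt if `∑ ‖Φ aₖ‖² < ∞` for an orthonormal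
basis `(aₖ)` of `G`. -/
def IsHilbertSchmidt (Φ : G →L[ℝ] H) : Prop :=
  ∃ (w : Set G) (a : HilbertBasis w ℝ G), Summable fun k => ‖Φ (a k)‖ ^ 2

/-- A linear map `X : G → L⁰(Ω; ℝ)` is a cylindrical random variable if it is continuous for the
topology of convergence in probability. -/
def IsCylindricalRV (P : Measure Ω) (X : G →ₗ[ℝ] (Ω →ₘ[P] ℝ)) : Prop :=
  ∀ g : G, TendstoInMeasure P (fun g' : G => (X g' : Ω → ℝ)) (𝓝 g) (X g)

/-- Lévy processes in a finite-dimensional space: start at `0`, independent and stationary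
increments, stochastic continuity. -/
structure IsLevyProcess {n : ℕ} (P : Measure Ω) (Z : ℝ≥0 → Ω → (Fin n → ℝ)) : Prop where
  aemeasurable : ∀ t, AEMeasurable (Z t) P
  zero : Z 0 =ᵐ[P] 0
  indep : HasIndepIncrements Z P
  stationary : ∀ s t : ℝ≥0, IdentDistrib (fun ω => Z (s + t) ω - Z s ω) (Z t) P P
  continuous : ∀ t : ℝ≥0, TendstoInMeasure P Z (𝓝 t) (Z t)

/-- A family `(L(t) : t ≥ 0)` of cylindrical random variables is a cylindrical Lévy process if all
its finite-dimensional projections are Lévy processes. -/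
structure IsCylindricalLevyProcess (P : Measure Ω) (L : ℝ≥0 → G →ₗ[ℝ] (Ω →ₘ[P] ℝ)) : Prop where
  cylindrical : ∀ t, IsCylindricalRV P (L t)
  levy : ∀ (n : ℕ) (g : Fin n → G), IsLevyProcess P fun t ω i => L t (g i) ω

/-- The filtration generated by `L`. Since `L(s)g` is an equivalence class, the σ-algebra generated
by it is the one generated by all its measurable representatives. -/
def generatedFiltration {P : Measure Ω} (L : ℝ≥0 → G →ₗ[ℝ] (Ω →ₘ[P] ℝ)) : Filtration ℝ≥0 mΩ where
  seq t := MeasurableSpace.generateFrom {A | ∃ s ≤ t, ∃ (g : G) (f : Ω → ℝ),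
    Measurable f ∧ f =ᵐ[P] L s g ∧ ∃ B : Set ℝ, MeasurableSet B ∧ f ⁻¹' B = A}
  mono' := by
    intro t u htu
    apply MeasurableSpace.generateFrom_mono
    rintro A ⟨s, hs, h⟩
    exact ⟨s, hs.trans htu, h⟩
  le' := by
    intro t
    apply MeasurableSpace.generateFrom_le
    rintro A ⟨s, -, g, f, hf, -, B, hB, rfl⟩
    exact hf hB

/-- `L` is a Lévy process relative to the filtration `𝓕`: it is adapted and its increments after
time `s` are independent of `𝓕 s`. -/
structure IsLevyFiltration (P : Measure Ω) (L : ℝ≥0 → G →ₗ[ℝ] (Ω →ₘ[P] ℝ))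
    (𝓕 : Filtration ℝ≥0 mΩ) : Prop where
  adapted : ∀ t g, AEStronglyMeasurable[𝓕 t] (L t g) P
  indep : ∀ s t, s ≤ t → ∀ (n : ℕ) (g : Fin n → G),
    Indep (MeasurableSpace.comap (fun ω (i : Fin n) => L t (g i) ω - L s (g i) ω) inferInstance)
      (𝓕 s) P

/-- Copying a linear map `X : G → L⁰(Ω)` onto the second factor of `Ω × Ω`:
`(X̃ g)(ω, ω') = (X g)(ω')`. -/
def secondCopy {P : Measure Ω} [IsProbabilityMeasure P] (X : G →ₗ[ℝ] (Ω →ₘ[P] ℝ)) :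
    G →ₗ[ℝ] (Ω × Ω →ₘ[P.prod P] ℝ) where
  toFun g := (X g).compMeasurePreserving Prod.snd measurePreserving_snd
  map_add' g g' := by
    rw [map_add]
    induction X g, X g' using AEEqFun.induction_on₂
    rfl
  map_smul' c g := by
    rw [map_smul]
    induction X g using AEEqFun.induction_on
    rfl

/-- The random variable `Y : Ω → H` induces the cylindrical random variable `Φ X` on `H`, that is
`⟨Y, h⟩ = X (Φ* h)` almost surely for every `h`. -/
def IsRadonification [MeasurableSpace H] {P : Measure Ω} (X : G →ₗ[ℝ] (Ω →ₘ[P] ℝ))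
    (Φ : G →L[ℝ] H) (Y : Ω → H) : Prop :=
  Measurable Y ∧
    ∀ h : H, (fun ω => inner ℝ (Y ω) h) =ᵐ[P] X (ContinuousLinearMap.adjoint Φ h)

/-- Observing a filtration at the times `t₀ ≤ … ≤ t_N`. -/
def sampledFiltration {N : ℕ} (𝓕 : Filtration ℝ≥0 mΩ) (t : Fin (N + 1) → ℝ≥0) (ht : Monotone t) :
    Filtration (Fin (N + 1)) mΩ where
  seq n := 𝓕 (t n)
  mono' _ _ h := 𝓕.mono (ht h)
  le' n := 𝓕.le (t n)

/-- A regular version of the conditional law `𝓛(X | m)` of the random variable `X : Ω → H`. -/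
def condLaw [SecondCountableTopology H] [MeasurableSpace H] [BorelSpace H]
    (P : Measure Ω) [IsProbabilityMeasure P] (m : MeasurableSpace Ω) (X : Ω → H) : Ω → Measure H :=
  fun ω => @condDistrib Ω Ω H _ _ _ mΩ m X id P _ ω

/-- Decoupled tangent sequences. The sequences `X₁, …, X_N` and `Y₁, …, Y_N` are indexed by
`n : Fin N`, with `n.castSucc` and `n.succ` playing the roles of `n - 1` and `n` in the filtrations
`𝓕₀ ⊆ … ⊆ 𝓕_N` and `𝓕'₀ ⊆ … ⊆ 𝓕'_N`; on the product space `X_n(ω, ω') = X_n(ω)`. -/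
structure IsDecoupledTangentSequence [SecondCountableTopology H] [MeasurableSpace H] [BorelSpace H]
    {N : ℕ} (P : Measure Ω) [IsProbabilityMeasure P] (𝓕 : Filtration (Fin (N + 1)) mΩ)
    (P' : Measure Ω') [IsProbabilityMeasure P'] (𝓕' : Filtration (Fin (N + 1)) mΩ')
    (X : Fin N → Ω → H) (Y : Fin N → Ω × Ω' → H) : Prop where
  adapted_left : ∀ n, Measurable[𝓕 n.succ] (X n)
  adapted_right : ∀ n, Measurable[(𝓕 n.succ).prod (𝓕' n.succ)] (Y n)
  indep : ∀ ω, iIndepFun (fun n ω' => Y n (ω, ω')) P'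
  tangent : ∀ n, ∀ᵐ z ∂(P.prod P'),
    condLaw (P.prod P') ((𝓕 n.castSucc).prod (𝓕' n.castSucc)) (fun z => X n z.1) z =
      condLaw (P.prod P') ((𝓕 n.castSucc).prod (𝓕' n.castSucc)) (Y n) z

end General

end CylLevy

end

open CylLevy

namespace CylLevy

/-! ### Independence of increments, pasts and copies -/

section Independence

variable {Ω : Type*} [mΩ : MeasurableSpace Ω] {P : Measure Ω}

/-! The sets `A n k` belong to the past at time `t n.castSucc`, and the vector `V` of Radonified
increments is independent of that past. Up to null sets, `X_n` and `Y_n` are the same function of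
the first coordinate `ω` and of `V`, read at `ω` for `X_n` and at `ω'` for `Y_n`. As `V` is
independent of the past, `((ω, ω'), V ω)` and `((ω, ω'), V ω')` have the same law when both
coordinates carry the past σ-algebra (`map_prod_fst_eq_map_prod_snd`), and a conditional law depends
only on this joint law (`condLaw_congr_of_map_eq`). With `ω` frozen, `Y_n` is a function of the
`n`-th vector of increments, so `iIndepFun_of_indep_past` gives independence in `n`.

The analytic part is the existence of Radonifications. Let `b` be an orthonormal basis of `H`, so
that `∑ ‖Φ* b_j‖² < ∞` for Hilbert-Schmidt `Φ`. The candidate is `∑ X(Φ* b_j) b_j`, which converges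
once the coefficients are almost surely square summable (`IsCylindricalRV.ae_summable_sq`).
Continuity in probability gives `E[1 - cos (X g)] ≤ ε + c ‖g‖²`. Averaging over Gaussian
combinations of vectors `g_i` yields `E[1 - exp (-∑ X(g_i)² / 2)] ≤ ε + c ∑ ‖g_i‖²`, and rescaling
the `g_i` shows that divergence has probability at most `ε`. -/

lemma indepFun_id_right_iff {Ω β : Type*} [MeasurableSpace β] {m mΩ : MeasurableSpace Ω}
    {P : Measure Ω} {f : Ω → β} :
    @IndepFun Ω β Ω mΩ _ m f id P ↔ Indep (MeasurableSpace.comap f inferInstance) m P := by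
  rw [@IndepFun_iff_Indep Ω β Ω mΩ _ m f id P, @MeasurableSpace.comap_id Ω m]

/-- A family of random variables is independent of a σ-algebra as soon as all its finite
subfamilies are. -/
lemma indep_comap_pi_of_finite [IsProbabilityMeasure P] {I : Type*} {F : I → Ω → ℝ}
    (hF : ∀ i, Measurable (F i)) {m : MeasurableSpace Ω} (hm : m ≤ mΩ)
    (h : ∀ (n : ℕ) (i : Fin n → I),
      Indep (MeasurableSpace.comap (fun ω (j : Fin n) => F (i j) ω) inferInstance) m P) :
    Indep (MeasurableSpace.comap (fun ω i => F i ω) inferInstance) m P := by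
  -- The identity into `(Ω, m)` presents the σ-algebra `m` as a random variable.
  have hid : @Measurable Ω Ω mΩ m id := fun s hs => hm s hs
  have key := @IndepFun.process_indepFun I Ω mΩ P (fun _ => ℝ) Ω _ m F id hF hid ?_ _
  · exact indepFun_id_right_iff.1 key
  · intro J
    have h1 := h J.card fun j => (J.equivFin.symm j : I)
    have h2 : @IndepFun Ω (Fin J.card → ℝ) Ω mΩ _ m
        (fun ω (j : Fin J.card) => F (J.equivFin.symm j : I) ω) id P := indepFun_id_right_iff.2 h1
    have h3 := @IndepFun.comp Ω (Fin J.card → ℝ) Ω (J → ℝ) Ω mΩ P _ _ _ m _ m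
      (φ := fun v i => v (J.equivFin i)) (ψ := id) h2
      (by fun_prop) (@measurable_id Ω m)
    simpa [Function.comp_def] using h3

/-- The increments after time `s` of a process with independent increments starting at `0` are
independent of finitely many of its values up to time `s`. -/
lemma indepFun_increment_past {E : Type*} [AddCommGroup E] [MeasurableSpace E]
    [MeasurableAdd₂ E] [MeasurableSub₂ E] {Z : ℝ≥0 → Ω → E} (hZ : ∀ t, Measurable (Z t))
    (hincr : HasIndepIncrements Z P) (h0 : Z 0 =ᵐ[P] 0) {s t : ℝ≥0} (hst : s ≤ t)
    {ι : Type*} [Finite ι] (r : ι → ℝ≥0) (hr : ∀ j, r j ≤ s) :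
    IndepFun (fun ω => Z t ω - Z s ω) (fun ω j => Z (r j) ω) P := by
  classical
  have := Fintype.ofFinite ι
  -- The time `0` is included so that values of `Z` telescope from zero, and `s` so that it is the
  -- last grid point.
  let S : Finset ℝ≥0 := insert 0 (insert s (Finset.univ.image r))
  have hS : ∀ x ∈ S, x ≤ s := by
    intro x hx
    simp only [S, Finset.mem_insert, Finset.mem_image, Finset.mem_univ, true_and] at hx
    rcases hx with rfl | rfl | ⟨j, rfl⟩
    · exact zero_le
    · exact le_rfl
    · exact hr j
  have hS0 : (0 : ℝ≥0) ∈ S := by simp [S]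
  have hSs : s ∈ S := by simp [S]
  have hSr : ∀ j, r j ∈ S := fun j => by simp [S]
  clear_value S
  let e : Fin S.card ↪o ℝ≥0 := S.orderEmbOfFin rfl
  have he : ∀ x ∈ S, ∃ i, e i = x := fun x hx => by
    have : x ∈ Set.range e := by rw [Finset.range_orderEmbOfFin]; exact hx
    exact this
  have heS : ∀ i, e i ∈ S := fun i => S.orderEmbOfFin_mem rfl i
  -- The grid in increasing order, then constantly `t`: the step after the last grid point `s` is
  -- the increment from `s` to `t`.
  let τ : ℕ → ℝ≥0 := fun i => if h : i < S.card then e ⟨i, h⟩ else t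
  have hτ : Monotone τ := by
    intro i j hij
    by_cases hj : j < S.card
    · have hi := hij.trans_lt hj
      simp only [τ, hi, hj, dif_pos]
      exact e.monotone hij
    · by_cases hi : i < S.card
      · simp only [τ, hi, hj, dif_pos, dif_neg, not_false_eq_true]
        exact (hS _ (heS _)).trans hst
      · simp [τ, hi, hj]
  obtain ⟨⟨k, hk⟩, hks⟩ := he s hSs
  obtain ⟨⟨z, hz⟩, hz0⟩ := he 0 hS0
  have hk1 : ∀ i : Fin S.card, i.1 ≤ k := fun i => by
    have := hS _ (heS i)
    rw [← hks, e.le_iff_le] at this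
    exact this
  have hk2 : ¬ k + 1 < S.card := fun h => by have := hk1 ⟨k + 1, h⟩; simp at this
  have hτs : τ k = s := by simp only [τ, hk, dif_pos, hks]
  have hτt : τ (k + 1) = t := by simp only [τ, hk2, dif_neg, not_false_eq_true]
  have hτ0 : τ 0 = 0 := by
    have h1 : τ z = 0 := by simp only [τ, hz, dif_pos, hz0]
    exact le_antisymm ((hτ (Nat.zero_le z)).trans h1.le) zero_le
  choose i hi using fun j => he (r j) (hSr j)
  have hτr : ∀ j, τ (i j) = r j := fun j => by simp only [τ, (i j).2, dif_pos, Fin.eta, hi]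
  have hD := hincr.nat hτ
  have hind := hD.indepFun_finset {k} (Finset.range k) (by simp)
    (fun i => (hZ _).sub (hZ _))
  have hcomp := hind.comp (φ := fun v : ({k} : Finset ℕ) → E => v ⟨k, by simp⟩)
    (ψ := fun (v : Finset.range k → E) (j : ι) =>
      ∑ l ∈ (Finset.univ : Finset (Finset.range k)).filter (fun l => l.1 < (i j).1), v l)
    (measurable_pi_apply (X := fun _ : ({k} : Finset ℕ) => E) _)
    (measurable_pi_lambda _ fun j => Finset.measurable_sum _ fun l _ => measurable_pi_apply l)
  refine hcomp.congr ?_ ?_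
  · simp only [Function.comp_def, hτs, hτt]
    exact .rfl
  · filter_upwards [h0] with ω hω
    funext j
    simp only [Function.comp_def]
    have h1 : ∑ l ∈ Finset.range (i j).1, (Z (τ (l + 1)) ω - Z (τ l) ω) = Z (r j) ω := by
      rw [Finset.sum_range_sub (fun l => Z (τ l) ω), hτ0, hω, hτr]
      simp
    rw [← h1]
    refine Finset.sum_bij (fun l _ => l.1) ?_ ?_ ?_ ?_
    · simp
    · intro a _ b _ h; exact Subtype.ext h
    · intro b hb
      have hb' := Finset.mem_range.1 hb
      exact ⟨⟨b, Finset.mem_range.2 (hb'.trans_le (hk1 _))⟩, by simpa using hb', rfl⟩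
    · simp

/-- Random variables, each measurable at its own time and independent of the past, are
independent. -/
lemma iIndepFun_of_indep_past [IsProbabilityMeasure P] {E : Type*} [MeasurableSpace E] {N : ℕ}
    (𝓖 : Filtration (Fin (N + 1)) mΩ) {V : Fin N → Ω → E}
    (hV : ∀ n, Measurable[𝓖 n.succ] (V n))
    (hind : ∀ n, Indep (MeasurableSpace.comap (V n) inferInstance) (𝓖 n.castSucc) P) :
    iIndepFun V P := by
  classical
  rw [iIndepFun_iff_measure_inter_preimage_eq_mul]
  intro S B hB
  induction S using Finset.induction_on_max with
  | empty => simp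
  | insert a S ha ih =>
    have haS : a ∉ S := fun h => lt_irrefl _ (ha a h)
    rw [Finset.set_biInter_insert, Finset.prod_insert haS,
      ← ih fun i hi => hB i (Finset.mem_insert_of_mem hi)]
    refine Indep_iff _ _ _ |>.1 (hind a) _ _ ⟨B a, hB a (Finset.mem_insert_self _ _), rfl⟩ ?_
    refine Finset.measurableSet_biInter _ fun i hi => ?_
    refine 𝓖.mono ?_ _ (hV i (hB i (Finset.mem_insert_of_mem hi)))
    -- For `i < a`, time `i.succ` is at most `a.castSucc`, so all earlier variables belong to the
    -- past of `V a`.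
    exact Fin.le_castSucc_iff.2 (Fin.succ_lt_succ_iff.2 (ha i hi))

/-- Given the σ-algebra generated by `f`, a random variable `V` independent of `f` may be replaced
by its copy on the second factor. -/
lemma map_prod_fst_eq_map_prod_snd [IsProbabilityMeasure P] {α E : Type*} [MeasurableSpace α]
    [MeasurableSpace E] {f : Ω → α} {V : Ω → E} (hf : Measurable f) (hV : Measurable V)
    (hind : IndepFun f V P) :
    (P.prod P).map (fun z => ((f z.1, f z.2), V z.1)) =
      (P.prod P).map (fun z => ((f z.1, f z.2), V z.2)) := by
  have hpair : ∀ {S : Set α} {B : Set E}, MeasurableSet S → MeasurableSet B →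
      P (f ⁻¹' S ∩ V ⁻¹' B) = P (f ⁻¹' S) * P (V ⁻¹' B) := fun hS hB =>
    hind.measure_inter_preimage_eq_mul _ _ hS hB
  have h1 : Measurable fun z : Ω × Ω => ((f z.1, f z.2), V z.1) := by fun_prop
  have h2 : Measurable fun z : Ω × Ω => ((f z.1, f z.2), V z.2) := by fun_prop
  have := Measure.isProbabilityMeasure_map (μ := P.prod P) h1.aemeasurable
  -- On boxes both laws factor into the same three probabilities; independence is used in the first
  -- coordinate for one law and in the second for the other.
  refine Measure.ext_prod₃_iff'.2 fun {S} {S'} {B} hS hS' hB => ?_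
  rw [Measure.map_apply h1 ((hS.prod hS').prod hB), Measure.map_apply h2 ((hS.prod hS').prod hB)]
  have e1 : (fun z : Ω × Ω => ((f z.1, f z.2), V z.1)) ⁻¹' ((S ×ˢ S') ×ˢ B) =
      (f ⁻¹' S ∩ V ⁻¹' B) ×ˢ (f ⁻¹' S') := by
    ext z; simp only [Set.mem_preimage, Set.mem_prod, Set.mem_inter_iff]; tauto
  have e2 : (fun z : Ω × Ω => ((f z.1, f z.2), V z.2)) ⁻¹' ((S ×ˢ S') ×ˢ B) =
      (f ⁻¹' S) ×ˢ (f ⁻¹' S' ∩ V ⁻¹' B) := by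
    ext z; simp only [Set.mem_preimage, Set.mem_prod, Set.mem_inter_iff]; tauto
  rw [e1, e2, Measure.prod_prod, Measure.prod_prod, hpair hS hB, hpair hS' hB]
  ring

end Independence

/-! ### Transport of Lévy processes along measure-preserving maps -/

section MeasurePreserving

variable {Ω : Type*} [mΩ : MeasurableSpace Ω] {P : Measure Ω}

lemma IsLevyProcess.congr {n : ℕ} {Z W : ℝ≥0 → Ω → (Fin n → ℝ)} (hZ : IsLevyProcess P Z)
    (h : ∀ t, Z t =ᵐ[P] W t) : IsLevyProcess P W where
  aemeasurable t := (hZ.aemeasurable t).congr (h t)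
  zero := (h 0).symm.trans hZ.zero
  indep k t ht := (hZ.indep k t ht).congr fun i => (h _).sub (h _)
  stationary s t := by
    have h1 : (fun ω => Z (s + t) ω - Z s ω) =ᵐ[P] fun ω => W (s + t) ω - W s ω :=
      (h (s + t)).sub (h s)
    have h2 := hZ.stationary s t
    exact ⟨h2.1.congr h1, h2.2.congr (h t), by
      rw [← Measure.map_congr h1, ← Measure.map_congr (h t), h2.3]⟩
  continuous t := (hZ.continuous t).congr h (h t)

lemma tendstoInMeasure_comp_measurePreserving {Ω' ι E : Type*} [MeasurableSpace Ω']
    {Q : Measure Ω'} [EDist E] {π : Ω' → Ω} (hπ : MeasurePreserving π Q P) {l : Filter ι}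
    {f : ι → Ω → E} {g : Ω → E} (h : TendstoInMeasure P f l g) :
    TendstoInMeasure Q (fun i => f i ∘ π) l (g ∘ π) := by
  intro ε hε
  refine tendsto_of_tendsto_of_tendsto_of_le_of_le tendsto_const_nhds (h ε hε)
    (fun _ => zero_le) fun i => ?_
  -- The deviation set need not be measurable, so it is replaced by its measurable hull, of the same
  -- measure.
  refine (measure_mono (μ := Q) (Set.preimage_mono (f := π)
    (subset_toMeasurable P {x | ε ≤ edist (f i x) (g x)}))).trans ?_
  rw [hπ.measure_preimage (measurableSet_toMeasurable _ _).nullMeasurableSet, measure_toMeasurable]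

lemma _root_.MeasureTheory.MeasurePreserving.map_comp_eq {Ω' E : Type*} [MeasurableSpace Ω']
    [MeasurableSpace E] {Q : Measure Ω'} {π : Ω' → Ω} (hπ : MeasurePreserving π Q P) {f : Ω → E}
    (hf : AEMeasurable f P) : Q.map (f ∘ π) = P.map f := by
  rw [← AEMeasurable.map_map_of_aemeasurable (hπ.map_eq.symm ▸ hf) hπ.aemeasurable, hπ.map_eq]

/-- Every clause concerns joint laws or convergence in measure, both of which survive composition
with a measure-preserving map. -/
lemma IsLevyProcess.comp_measurePreserving [IsProbabilityMeasure P] {Ω' : Type*}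
    [MeasurableSpace Ω'] {Q : Measure Ω'} [IsProbabilityMeasure Q]
    {π : Ω' → Ω} (hπ : MeasurePreserving π Q P) {n : ℕ} {Z : ℝ≥0 → Ω → (Fin n → ℝ)}
    (hZ : IsLevyProcess P Z) : IsLevyProcess Q fun t => Z t ∘ π where
  aemeasurable t := (hZ.aemeasurable t).comp_quasiMeasurePreserving hπ.quasiMeasurePreserving
  zero := hπ.quasiMeasurePreserving.ae_eq_comp hZ.zero
  indep k t ht := by
    have h := hZ.indep k t ht
    have hm : ∀ i : Fin k, AEMeasurable (fun ω => Z (t i.succ) ω - Z (t i.castSucc) ω) P :=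
      fun i => (hZ.aemeasurable _).sub (hZ.aemeasurable _)
    have hm' := fun i => (hm i).comp_quasiMeasurePreserving hπ.quasiMeasurePreserving
    have h1 := (iIndepFun_iff_map_fun_eq_pi_map hm).1 h
    refine (iIndepFun_iff_map_fun_eq_pi_map hm').2 ?_
    have h2 : Measure.pi
        (fun i : Fin k => Q.map ((fun ω => Z (t i.succ) ω - Z (t i.castSucc) ω) ∘ π)) =
        Measure.pi (fun i : Fin k => P.map (fun ω => Z (t i.succ) ω - Z (t i.castSucc) ω)) := by
      congr 1
      funext i
      exact hπ.map_comp_eq (hm i)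
    rw [h2, ← h1]
    exact hπ.map_comp_eq (aemeasurable_pi_lambda _ hm)
  stationary s t := by
    have h := hZ.stationary s t
    refine ⟨h.1.comp_quasiMeasurePreserving hπ.quasiMeasurePreserving,
      h.2.comp_quasiMeasurePreserving hπ.quasiMeasurePreserving, ?_⟩
    exact (hπ.map_comp_eq h.1).trans (h.3.trans (hπ.map_comp_eq h.2).symm)
  continuous t := tendstoInMeasure_comp_measurePreserving hπ (hZ.continuous t)

end MeasurePreserving

/-! ### The generated filtration and the copied process -/

section CylindricalLevy

variable {Ω : Type*} [mΩ : MeasurableSpace Ω] {P : Measure Ω} [IsProbabilityMeasure P]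
variable {G : Type*} [NormedAddCommGroup G] [InnerProductSpace ℝ G]

/-- The generated filtration is admissible. -/
lemma IsCylindricalLevyProcess.isLevyFiltration_generatedFiltration
    {L : ℝ≥0 → G →ₗ[ℝ] (Ω →ₘ[P] ℝ)} (hL : IsCylindricalLevyProcess P L) :
    IsLevyFiltration P L (generatedFiltration L) where
  adapted t g := by
    refine Measurable.aestronglyMeasurable ?_
    intro B hB
    exact MeasurableSpace.measurableSet_generateFrom
      ⟨t, le_rfl, g, L t g, (L t g).measurable, .rfl, B, hB, rfl⟩
  indep s t hst n g := by
    -- All measurable representatives of all values up to time `s`: this uncountable family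
    -- generates the past, and finite subfamilies suffice for independence.
    let I := {p : ℝ≥0 × G × (Ω → ℝ) // p.1 ≤ s ∧ Measurable p.2.2 ∧ p.2.2 =ᵐ[P] L p.1 p.2.1}
    let F : I → Ω → ℝ := fun p => p.1.2.2
    have hle : generatedFiltration L s ≤
        MeasurableSpace.comap (fun ω i => F i ω) inferInstance := by
      refine MeasurableSpace.generateFrom_le ?_
      rintro A ⟨r, hr, g', f, hf, hfL, B, hB, rfl⟩
      let p : I := ⟨(r, g', f), hr, hf, hfL⟩
      exact ⟨(fun v => v p) ⁻¹' B, measurable_pi_apply p hB, rfl⟩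
    have hX : Measurable fun ω (i : Fin n) => L t (g i) ω - L s (g i) ω :=
      measurable_pi_lambda _ fun i => (L t (g i)).measurable.sub (L s (g i)).measurable
    refine indep_of_indep_of_le_right ?_ hle
    refine (indep_comap_pi_of_finite (fun p : I => p.2.2.1) hX.comap_le fun m p => ?_).symm
    refine Indep.symm ?_
    -- The directions of the increment and those of the past values are stacked into one
    -- finite-dimensional Lévy process; the two blocks are read off afterwards.
    let Z : ℝ≥0 → Ω → (Fin (n + m) → ℝ) := fun u ω i =>
      L u (Fin.append g (fun j => (p j).1.2.1) i) ω
    have hZ := hL.levy (n + m) (Fin.append g fun j => (p j).1.2.1)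
    have hZm : ∀ u, Measurable (Z u) := fun u =>
      measurable_pi_lambda _ fun i => (L u _).measurable
    have h1 := indepFun_increment_past hZm hZ.indep hZ.zero hst (fun j => (p j).1.1)
      fun j => (p j).2.1
    have h2 := h1.comp (φ := fun v (i : Fin n) => v (Fin.castAdd m i))
      (ψ := fun w (j : Fin m) => w j (Fin.natAdd n j)) (by fun_prop) (by fun_prop)
    rw [← IndepFun_iff_Indep]
    refine h2.congr ?_ ?_
    · refine .of_eq ?_
      funext ω i
      simp [Z]
    · have : ∀ᵐ ω ∂P, ∀ j, F (p j) ω = L (p j).1.1 (p j).1.2.1 ω :=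
        ae_all_iff.2 fun j => (p j).2.2.2
      filter_upwards [this] with ω hω
      funext j
      simpa [Z] using (hω j).symm

lemma coeFn_secondCopy (X : G →ₗ[ℝ] (Ω →ₘ[P] ℝ)) (g : G) :
    (secondCopy X g : Ω × Ω → ℝ) =ᵐ[P.prod P] fun z => X g z.2 :=
  AEEqFun.coeFn_compMeasurePreserving _ measurePreserving_snd

/-- The copy of a cylindrical Lévy process is a cylindrical Lévy process. -/
lemma IsCylindricalLevyProcess.secondCopy
    {L : ℝ≥0 → G →ₗ[ℝ] (Ω →ₘ[P] ℝ)} (hL : IsCylindricalLevyProcess P L) :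
    IsCylindricalLevyProcess (P.prod P) (fun t => secondCopy (L t)) where
  cylindrical t g :=
    (tendstoInMeasure_comp_measurePreserving (measurePreserving_snd (μ := P) (ν := P))
      (hL.cylindrical t g)).congr (fun g' => (coeFn_secondCopy (L t) g').symm)
      (coeFn_secondCopy (L t) g).symm
  levy n g := by
    refine ((hL.levy n g).comp_measurePreserving (measurePreserving_snd (μ := P) (ν := P))).congr
      fun t => ?_
    have : ∀ᵐ z ∂(P.prod P), ∀ i, CylLevy.secondCopy (L t) (g i) z = L t (g i) z.2 :=
      ae_all_iff.2 fun i => coeFn_secondCopy (L t) (g i)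
    filter_upwards [this] with z hz
    funext i
    exact (hz i).symm

end CylindricalLevy

/-! ### Gaussian averages -/

section Gaussian

variable {ι : Type*} [Fintype ι]

/-- The real part of the Gaussian characteristic function; it turns an exponential of a sum of
squares into an average of cosines of linear forms. -/
lemma integral_cos_inner_stdGaussian (a : EuclideanSpace ℝ ι) :
    ∫ x, Real.cos (inner ℝ x a) ∂(stdGaussian (EuclideanSpace ℝ ι)) =
      Real.exp (-‖a‖ ^ 2 / 2) := by
  have h := congrArg Complex.re (charFun_stdGaussian a)
  rw [charFun_apply] at h
  have hint : Integrable (fun x : EuclideanSpace ℝ ι => Complex.exp (inner ℝ x a * Complex.I))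
      (stdGaussian (EuclideanSpace ℝ ι)) := by
    refine Integrable.of_bound (C := 1) (Measurable.aestronglyMeasurable (by fun_prop))
      (ae_of_all _ fun x => ?_)
    rw [Complex.norm_exp_ofReal_mul_I]
  have hre : ∀ x : EuclideanSpace ℝ ι,
      RCLike.re (Complex.exp (inner ℝ x a * Complex.I)) = Real.cos (inner ℝ x a) := fun x => by
    rw [RCLike.re_eq_complex_re, Complex.exp_ofReal_mul_I_re]
  have hexp : Complex.exp (-(‖a‖ : ℂ) ^ 2 / 2) = ((Real.exp (-‖a‖ ^ 2 / 2) : ℝ) : ℂ) := by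
    push_cast; rfl
  calc ∫ x, Real.cos (inner ℝ x a) ∂(stdGaussian (EuclideanSpace ℝ ι))
      = ∫ x, RCLike.re (Complex.exp (inner ℝ x a * Complex.I))
          ∂(stdGaussian (EuclideanSpace ℝ ι)) :=
        integral_congr_ae (ae_of_all _ fun x => (hre x).symm)
    _ = Complex.re (∫ x, Complex.exp (inner ℝ x a * Complex.I)
          ∂(stdGaussian (EuclideanSpace ℝ ι))) := integral_re hint
    _ = Real.exp (-‖a‖ ^ 2 / 2) := by rw [h, hexp, Complex.ofReal_re]

lemma memLp_apply_stdGaussian (i : ι) :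
    MemLp (fun x : EuclideanSpace ℝ ι => x i) 2 (stdGaussian (EuclideanSpace ℝ ι)) := by
  have h := IsGaussian.memLp_two_id (μ := stdGaussian (EuclideanSpace ℝ ι))
  exact (EuclideanSpace.proj (𝕜 := ℝ) i).comp_memLp' h

lemma integral_apply_mul_apply_stdGaussian [DecidableEq ι] (i j : ι) :
    ∫ x : EuclideanSpace ℝ ι, x i * x j ∂(stdGaussian (EuclideanSpace ℝ ι)) =
      if i = j then 1 else 0 := by
  have h := covarianceBilin_apply (μ := stdGaussian (EuclideanSpace ℝ ι))
    IsGaussian.memLp_two_id (EuclideanSpace.single i (1 : ℝ)) (EuclideanSpace.single j (1 : ℝ))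
  rw [covarianceBilin_stdGaussian] at h
  rw [innerSL_apply_apply ℝ] at h
  simpa [integral_id_stdGaussian, EuclideanSpace.inner_single_left, eq_comm] using h.symm

lemma integrable_norm_sum_sq_stdGaussian {G : Type*} [NormedAddCommGroup G]
    [InnerProductSpace ℝ G] (g : ι → G) :
    Integrable (fun x : EuclideanSpace ℝ ι => ‖∑ i, x i • g i‖ ^ 2)
      (stdGaussian (EuclideanSpace ℝ ι)) := by
  simp_rw [← real_inner_self_eq_norm_sq, sum_inner, inner_sum, real_inner_smul_left,
    real_inner_smul_right, ← mul_assoc]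
  exact integrable_finsetSum _ fun i _ => integrable_finsetSum _ fun j _ =>
    ((memLp_apply_stdGaussian i).integrable_mul (memLp_apply_stdGaussian j)).mul_const _

/-- The coordinates are uncorrelated with unit variance, so only the diagonal of the expanded square
remains. -/
lemma integral_norm_sum_sq_stdGaussian {G : Type*} [NormedAddCommGroup G]
    [InnerProductSpace ℝ G] (g : ι → G) :
    ∫ x : EuclideanSpace ℝ ι, ‖∑ i, x i • g i‖ ^ 2 ∂(stdGaussian (EuclideanSpace ℝ ι)) =
      ∑ i, ‖g i‖ ^ 2 := by
  classical
  have hint : ∀ i j, Integrable (fun x : EuclideanSpace ℝ ι => x i * x j * inner ℝ (g i) (g j))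
      (stdGaussian (EuclideanSpace ℝ ι)) := fun i j =>
    ((memLp_apply_stdGaussian i).integrable_mul (memLp_apply_stdGaussian j)).mul_const _
  simp_rw [← real_inner_self_eq_norm_sq, sum_inner, inner_sum, real_inner_smul_left,
    real_inner_smul_right, ← mul_assoc]
  rw [integral_finsetSum _ fun i _ => integrable_finsetSum _ fun j _ => hint i j]
  simp_rw [integral_finsetSum _ fun j _ => hint _ j, integral_mul_const,
    integral_apply_mul_apply_stdGaussian]
  simp

end Gaussian

/-! ### Almost sure square summability -/

section Radonification

variable {Ω : Type*} [mΩ : MeasurableSpace Ω] {P : Measure Ω} [IsProbabilityMeasure P]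
variable {G : Type*} [NormedAddCommGroup G] [InnerProductSpace ℝ G]

lemma coeFn_map_sum_smul {Ω : Type*} [MeasurableSpace Ω] {P : Measure Ω}
    (X : G →ₗ[ℝ] (Ω →ₘ[P] ℝ)) {ι : Type*} (s : Finset ι) (c : ι → ℝ) (g : ι → G) :
    (X (∑ i ∈ s, c i • g i) : Ω → ℝ) =ᵐ[P] fun ω => ∑ i ∈ s, c i * X (g i) ω := by
  classical
  induction s using Finset.induction_on with
  | empty =>
    rw [Finset.sum_empty, map_zero]
    filter_upwards [AEEqFun.coeFn_zero (μ := P) (β := ℝ) (α := Ω)] with ω hω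
    simpa using hω
  | insert i s his ih =>
    rw [Finset.sum_insert his, map_add, map_smul]
    filter_upwards [ih, AEEqFun.coeFn_add (c i • X (g i)) (X (∑ i ∈ s, c i • g i)),
      AEEqFun.coeFn_smul (c i) (X (g i))] with ω h1 h2 h3
    rw [h2, Pi.add_apply, h3, h1, Finset.sum_insert his]
    rfl

lemma tendsto_sum_atTop_of_not_summable {ι : Type*} {f : ι → ℝ} (hf : ∀ i, 0 ≤ f i)
    (hns : ¬ Summable f) : Tendsto (fun s : Finset ι => ∑ i ∈ s, f i) atTop atTop := by
  rw [tendsto_atTop_atTop]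
  by_contra! h
  obtain ⟨b, hb⟩ := h
  refine hns (summable_of_sum_le (c := b) hf fun s => ?_)
  obtain ⟨s', hs', hlt⟩ := hb s
  exact (Finset.sum_le_sum_of_subset_of_nonneg hs' fun i _ _ => hf i).trans hlt.le

lemma measurableSet_summable_sq {Ω : Type*} [MeasurableSpace Ω] {ι : Type*} [Countable ι]
    {a : ι → Ω → ℝ} (ha : ∀ i, Measurable (a i)) :
    MeasurableSet {ω | Summable fun i => a i ω ^ 2} := by
  have h : {ω | Summable fun i => a i ω ^ 2} = {ω | ∑' i, ENNReal.ofReal (a i ω ^ 2) ≠ ⊤} := by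
    ext ω
    refine ⟨fun hs => hs.tsum_ofReal_ne_top, fun hs => ?_⟩
    have := ENNReal.summable_toReal hs
    simpa [ENNReal.toReal_ofReal (sq_nonneg _)] using this
  rw [h]
  have hm : Measurable fun ω => ∑' i, ENNReal.ofReal (a i ω ^ 2) :=
    Measurable.tsum fun i => ((ha i).pow_const 2).ennreal_ofReal
  exact (hm (measurableSet_singleton ⊤)).compl

lemma integrable_one_sub_cos {Ω : Type*} [MeasurableSpace Ω] {P : Measure Ω} [IsFiniteMeasure P]
    {f : Ω → ℝ} (hf : AEStronglyMeasurable f P) :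
    Integrable (fun ω => 1 - Real.cos (f ω)) P := by
  refine Integrable.of_bound (C := 2)
    (aestronglyMeasurable_const.sub (Real.continuous_cos.comp_aestronglyMeasurable hf))
    (ae_of_all _ fun ω => ?_)
  rw [Real.norm_eq_abs, abs_le]
  constructor <;> linarith [Real.cos_le_one (f ω), Real.neg_one_le_cos (f ω)]

/-- Continuity in probability of a cylindrical random variable, expressed through the real part of
its characteristic function. -/
lemma IsCylindricalRV.exists_integral_one_sub_cos_le {X : G →ₗ[ℝ] (Ω →ₘ[P] ℝ)}
    (hX : IsCylindricalRV P X) {ε : ℝ} (hε : 0 < ε) :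
    ∃ c : ℝ, 0 ≤ c ∧ ∀ g, ∫ ω, (1 - Real.cos (X g ω)) ∂P ≤ ε + c * ‖g‖ ^ 2 := by
  have h0 : TendstoInMeasure P (fun g : G => (X g : Ω → ℝ)) (𝓝 0) (fun _ => 0) := by
    refine (hX 0).congr_right ?_
    rw [map_zero]
    exact AEEqFun.coeFn_zero
  rw [tendstoInMeasure_iff_measureReal_norm] at h0
  -- Where `|X g| < η`, `1 - cos` is at most `η² / 2 ≤ ε / 2`; elsewhere it is at most `2`, on an
  -- event of probability below `ε / 4`.
  let η := min 1 ε
  have hη : 0 < η := lt_min one_pos hε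
  have hη2 : η ^ 2 / 2 ≤ ε / 2 := by
    have h1 : η ≤ 1 := min_le_left _ _
    have h2 : η ≤ ε := min_le_right _ _
    nlinarith
  have hev := (h0 η hη).eventually (gt_mem_nhds (show (0 : ℝ) < ε / 4 by positivity))
  obtain ⟨δ, hδ, hball⟩ := Metric.eventually_nhds_iff.1 hev
  have hb : ∀ g, ∫ ω, (1 - Real.cos (X g ω)) ∂P ≤ 2 := fun g => by
    calc ∫ ω, (1 - Real.cos (X g ω)) ∂P ≤ ∫ _, (2 : ℝ) ∂P :=
          integral_mono (integrable_one_sub_cos (X g).aestronglyMeasurable) (integrable_const _)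
            fun ω => by linarith [Real.neg_one_le_cos (X g ω)]
      _ = 2 := by simp
  -- With this constant the quadratic term is at least the trivial bound `2` once `‖g‖ ≥ δ`.
  refine ⟨2 / δ ^ 2, by positivity, fun g => ?_⟩
  by_cases hg : ‖g‖ < δ
  · have hP := hball (y := g) (by simpa using hg)
    simp only [sub_zero] at hP
    set S := {ω | η ≤ ‖X g ω‖} with hS
    have hSm : MeasurableSet S := measurableSet_le measurable_const (X g).measurable.norm
    have hle : ∀ ω, 1 - Real.cos (X g ω) ≤ ε / 2 + S.indicator (fun _ => 2) ω := by
      intro ω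
      by_cases hω : ω ∈ S
      · rw [Set.indicator_of_mem hω]
        linarith [Real.neg_one_le_cos (X g ω)]
      · rw [Set.indicator_of_notMem hω]
        have h1 : |X g ω| < η := by simpa [hS] using hω
        have h2 := Real.one_sub_sq_div_two_le_cos (x := X g ω)
        have h3 : (X g ω) ^ 2 ≤ η ^ 2 := by
          rw [← sq_abs]; exact pow_le_pow_left₀ (abs_nonneg _) h1.le 2
        linarith
    calc ∫ ω, (1 - Real.cos (X g ω)) ∂P
        ≤ ∫ ω, (ε / 2 + S.indicator (fun _ => (2 : ℝ)) ω) ∂P :=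
          integral_mono (integrable_one_sub_cos (X g).aestronglyMeasurable)
            ((integrable_const _).add ((integrable_const _).indicator hSm)) hle
      _ = ε / 2 + P.real S * 2 := by
          rw [integral_add (integrable_const _) ((integrable_const _).indicator hSm),
            integral_indicator_const _ hSm]
          simp
      _ ≤ ε + 2 / δ ^ 2 * ‖g‖ ^ 2 := by
          have : 0 ≤ 2 / δ ^ 2 * ‖g‖ ^ 2 := by positivity
          linarith
  · have h1 : 2 ≤ 2 / δ ^ 2 * ‖g‖ ^ 2 := by
      rw [div_mul_eq_mul_div, le_div_iff₀ (by positivity)]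
      have := pow_le_pow_left₀ hδ.le (not_lt.1 hg) 2
      linarith
    linarith [hb g]

/-- Gaussian averaging of the bound on the characteristic function of `X`. -/
lemma integral_one_sub_exp_le {X : G →ₗ[ℝ] (Ω →ₘ[P] ℝ)} {ε c : ℝ}
    (hb : ∀ g, ∫ ω, (1 - Real.cos (X g ω)) ∂P ≤ ε + c * ‖g‖ ^ 2)
    {ι : Type*} [Fintype ι] {g : ι → G} {a : ι → Ω → ℝ} (ha : ∀ i, Measurable (a i))
    (hag : ∀ i, a i =ᵐ[P] X (g i)) :
    ∫ ω, (1 - Real.exp (-(∑ i, a i ω ^ 2) / 2)) ∂P ≤ ε + c * ∑ i, ‖g i‖ ^ 2 := by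
  let γ := stdGaussian (EuclideanSpace ℝ ι)
  let f : Ω → EuclideanSpace ℝ ι → ℝ := fun ω x => ∑ i, x i * a i ω
  have hfm : Measurable (fun z : Ω × EuclideanSpace ℝ ι => f z.1 z.2) :=
    Finset.measurable_sum _ fun i _ => (by fun_prop)
  have h1 : ∀ ω, 1 - Real.exp (-(∑ i, a i ω ^ 2) / 2) = ∫ x, (1 - Real.cos (f ω x)) ∂γ := by
    intro ω
    have hcos := integral_cos_inner_stdGaussian (WithLp.toLp 2 fun i => a i ω)
    have hin : ∀ x : EuclideanSpace ℝ ι, inner ℝ x (WithLp.toLp 2 fun i => a i ω) = f ω x := by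
      intro x
      simp [f, PiLp.inner_apply, mul_comm]
    simp_rw [hin, EuclideanSpace.real_norm_sq_eq] at hcos
    have hi : Integrable (fun x => Real.cos (f ω x)) γ := by
      have := (integrable_const (1 : ℝ)).sub
        (integrable_one_sub_cos (P := γ) (f := f ω) (by
          exact (hfm.comp measurable_prodMk_left).aestronglyMeasurable))
      refine this.congr (ae_of_all _ fun x => ?_)
      simp
    rw [integral_sub (integrable_const _) hi]
    simp [γ, hcos]
  have h2 : ∀ x : EuclideanSpace ℝ ι,
      ∫ ω, (1 - Real.cos (f ω x)) ∂P ≤ ε + c * ‖∑ i, x i • g i‖ ^ 2 := by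
    intro x
    refine le_trans (le_of_eq (integral_congr_ae ?_)) (hb (∑ i, x i • g i))
    filter_upwards [coeFn_map_sum_smul X Finset.univ x g, ae_all_iff.2 hag] with ω h3 h4
    simp only [f, h3, h4]
  calc ∫ ω, (1 - Real.exp (-(∑ i, a i ω ^ 2) / 2)) ∂P
      = ∫ ω, ∫ x, (1 - Real.cos (f ω x)) ∂γ ∂P := by simp_rw [h1]
    _ = ∫ x, ∫ ω, (1 - Real.cos (f ω x)) ∂P ∂γ :=
        integral_integral_swap (integrable_one_sub_cos (P := P.prod γ)
          (f := fun z => f z.1 z.2) hfm.aestronglyMeasurable)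
    _ ≤ ∫ x, (ε + c * ‖∑ i, x i • g i‖ ^ 2) ∂γ := by
        refine integral_mono ?_ ?_ h2
        · exact (integrable_one_sub_cos (P := P.prod γ)
            (f := fun z => f z.1 z.2) hfm.aestronglyMeasurable).integral_prod_right
        · exact (integrable_const _).add ((integrable_norm_sum_sq_stdGaussian g).const_mul c)
    _ = ε + c * ∑ i, ‖g i‖ ^ 2 := by
        rw [integral_add (integrable_const _) ((integrable_norm_sum_sq_stdGaussian g).const_mul c),
          integral_const_mul, integral_norm_sum_sq_stdGaussian]
        simp

/-- A continuous cylindrical random variable maps square summable families to families that are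
almost surely square summable. -/
lemma IsCylindricalRV.ae_summable_sq {X : G →ₗ[ℝ] (Ω →ₘ[P] ℝ)} (hX : IsCylindricalRV P X)
    {ι : Type*} [Countable ι] {g : ι → G} (hg : Summable fun i => ‖g i‖ ^ 2)
    {a : ι → Ω → ℝ} (ha : ∀ i, Measurable (a i)) (hag : ∀ i, a i =ᵐ[P] X (g i)) :
    ∀ᵐ ω ∂P, Summable fun i => a i ω ^ 2 := by
  classical
  let S : Set Ω := {ω | Summable fun i => a i ω ^ 2}
  have hS : MeasurableSet S := measurableSet_summable_sq ha
  -- On the divergence set the integrand tends to `1` for every scale `δ`, so its integral tends to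
  -- the probability of divergence.
  have hlim : ∀ δ : ℝ, 0 < δ → ∀ ω, Tendsto (fun s : Finset ι =>
      Sᶜ.indicator (fun ω => 1 - Real.exp (-(∑ i ∈ s, (δ * a i ω) ^ 2) / 2)) ω) atTop
      (𝓝 (Sᶜ.indicator (fun _ => (1 : ℝ)) ω)) := by
    intro δ hδ ω
    by_cases hω : ω ∈ Sᶜ
    · simp only [Set.indicator_of_mem hω]
      have hns : ¬ Summable fun i => (δ * a i ω) ^ 2 := by
        simp_rw [mul_pow]
        rw [summable_mul_left_iff (by positivity)]
        exact hω
      have htop : Tendsto (fun s : Finset ι => ∑ i ∈ s, (δ * a i ω) ^ 2) atTop atTop :=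
        tendsto_sum_atTop_of_not_summable (fun i => sq_nonneg _) hns
      have h2 : Tendsto (fun s : Finset ι => -(∑ i ∈ s, (δ * a i ω) ^ 2) / 2) atTop atBot :=
        (tendsto_neg_atTop_atBot.comp htop).atBot_div_const two_pos
      simpa using (Real.tendsto_exp_atBot.comp h2).const_sub 1
    · simp [Set.indicator_of_notMem hω]
  have hbound : ∀ ε : ℝ, 0 < ε → P.real Sᶜ ≤ ε := by
    intro ε hε
    obtain ⟨c, hc, hb⟩ := hX.exists_integral_one_sub_cos_le (ε := ε / 2) (by positivity)
    set K := ∑' i, ‖g i‖ ^ 2 with hK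
    have hK0 : 0 ≤ K := tsum_nonneg fun i => sq_nonneg _
    -- Since `c` depends only on `ε`, the scale can be chosen afterwards; scaling by `δ` leaves the
    -- divergence set unchanged. The `+ 1` in the witness keeps the denominator positive.
    obtain ⟨δ, hδ, hδK⟩ : ∃ δ : ℝ, 0 < δ ∧ δ ^ 2 * (c * K) ≤ ε / 2 := by
      refine ⟨Real.sqrt (ε / 2 / (c * K + 1)), by positivity, ?_⟩
      rw [Real.sq_sqrt (by positivity), div_mul_eq_mul_div, div_le_iff₀ (by positivity)]
      nlinarith [mul_nonneg hc hK0]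
    have hfin : ∀ s : Finset ι, ∫ ω, Sᶜ.indicator
        (fun ω => 1 - Real.exp (-(∑ i ∈ s, (δ * a i ω) ^ 2) / 2)) ω ∂P ≤ ε := by
      intro s
      have h1 := integral_one_sub_exp_le hb (g := fun i : s => δ • g i)
        (a := fun i : s => fun ω => δ * a i ω) (fun i => (ha i).const_mul δ) (fun i => by
          rw [map_smul]
          filter_upwards [hag i, AEEqFun.coeFn_smul δ (X (g i))] with ω h1 h2
          rw [h2, h1]; rfl)
      have h2 : ∑ i : s, ‖δ • g i‖ ^ 2 ≤ δ ^ 2 * K := by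
        rw [Finset.sum_coe_sort s fun i => ‖δ • g i‖ ^ 2]
        simp_rw [norm_smul, mul_pow, ← Finset.mul_sum, Real.norm_eq_abs, sq_abs]
        exact mul_le_mul_of_nonneg_left (hg.sum_le_tsum s fun i _ => sq_nonneg _) (sq_nonneg _)
      have h3 : ∀ ω, ∑ i : s, (δ * a i ω) ^ 2 = ∑ i ∈ s, (δ * a i ω) ^ 2 := fun ω =>
        Finset.sum_coe_sort s fun i => (δ * a i ω) ^ 2
      simp_rw [h3] at h1
      have hnn : ∀ ω, 0 ≤ 1 - Real.exp (-(∑ i ∈ s, (δ * a i ω) ^ 2) / 2) := fun ω => by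
        have : 0 ≤ ∑ i ∈ s, (δ * a i ω) ^ 2 := Finset.sum_nonneg fun i _ => sq_nonneg _
        have := Real.exp_le_one_iff.2 (show -(∑ i ∈ s, (δ * a i ω) ^ 2) / 2 ≤ 0 by linarith)
        linarith
      have hint : Integrable (fun ω => 1 - Real.exp (-(∑ i ∈ s, (δ * a i ω) ^ 2) / 2)) P := by
        refine Integrable.of_bound (C := 1) (Measurable.aestronglyMeasurable ?_)
          (ae_of_all _ fun ω => ?_)
        · have := Finset.measurable_sum s fun i _ => ((ha i).const_mul δ).pow_const 2
          fun_prop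
        · rw [Real.norm_of_nonneg (hnn ω)]
          linarith [Real.exp_pos (-(∑ i ∈ s, (δ * a i ω) ^ 2) / 2)]
      calc _ ≤ ∫ ω, (1 - Real.exp (-(∑ i ∈ s, (δ * a i ω) ^ 2) / 2)) ∂P :=
            integral_mono (hint.indicator hS.compl) hint
              (Set.indicator_le_self' fun ω _ => hnn ω)
        _ ≤ ε / 2 + c * ∑ i : s, ‖δ • g i‖ ^ 2 := h1
        _ ≤ ε / 2 + c * (δ ^ 2 * K) := by gcongr
        _ ≤ ε := by linarith
    have hDCT : Tendsto (fun s : Finset ι => ∫ ω, Sᶜ.indicator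
        (fun ω => 1 - Real.exp (-(∑ i ∈ s, (δ * a i ω) ^ 2) / 2)) ω ∂P) atTop
        (𝓝 (∫ ω, Sᶜ.indicator (fun _ => (1 : ℝ)) ω ∂P)) := by
      -- Countability of `ι` makes `atTop` on `Finset ι` countably generated, as dominated
      -- convergence requires.
      refine tendsto_integral_filter_of_dominated_convergence (fun _ => 1) ?_ ?_
        (integrable_const _) (ae_of_all _ (hlim δ hδ))
      · refine .of_forall fun s => Measurable.aestronglyMeasurable ?_
        refine Measurable.indicator ?_ hS.compl
        have := Finset.measurable_sum s fun i _ => ((ha i).const_mul δ).pow_const 2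
        fun_prop
      · refine .of_forall fun s => ae_of_all _ fun ω => ?_
        refine (norm_indicator_le_norm_self _ _).trans ?_
        have : 0 ≤ ∑ i ∈ s, (δ * a i ω) ^ 2 := Finset.sum_nonneg fun i _ => sq_nonneg _
        have := Real.exp_le_one_iff.2 (show -(∑ i ∈ s, (δ * a i ω) ^ 2) / 2 ≤ 0 by linarith)
        rw [Real.norm_of_nonneg (by linarith)]
        linarith [Real.exp_pos (-(∑ i ∈ s, (δ * a i ω) ^ 2) / 2)]
    have := le_of_tendsto hDCT (.of_forall hfin)
    rw [integral_indicator_const _ hS.compl] at this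
    simpa using this
  have hzero : P.real Sᶜ = 0 :=
    le_antisymm (le_of_forall_pos_le_add fun ε hε => by simpa using hbound ε hε)
      measureReal_nonneg
  rw [measureReal_eq_zero_iff] at hzero
  exact hzero

end Radonification

/-! ### Orthonormal bases and Hilbert-Schmidt operators -/

section HilbertSchmidt

variable {G H : Type*} [NormedAddCommGroup G] [InnerProductSpace ℝ G]
  [NormedAddCommGroup H] [InnerProductSpace ℝ H]

/-- Distinct orthonormal vectors are `√2` apart, so balls of radius `1/2` around them are disjoint,
and a second countable space has only countably many disjoint nonempty open sets. -/
lemma _root_.Orthonormal.countable_index [SecondCountableTopology H] {ι : Type*} {v : ι → H}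
    (hv : Orthonormal ℝ v) : Countable ι := by
  have hdist : ∀ i j, i ≠ j → 1 ≤ dist (v i) (v j) := by
    intro i j hij
    have h1 : ‖v i - v j‖ ^ 2 = 2 := by
      rw [norm_sub_sq_real, hv.1 i, hv.1 j, hv.2 hij]
      norm_num
    rw [dist_eq_norm]
    nlinarith [norm_nonneg (v i - v j)]
  have hdisj : (Set.univ : Set ι).PairwiseDisjoint fun i => Metric.ball (v i) (1 / 2) := by
    intro i _ j _ hij
    refine Metric.ball_disjoint_ball ?_
    linarith [hdist i j hij]
  have := hdisj.countable_of_isOpen (fun i _ => Metric.isOpen_ball)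
    fun i _ => ⟨v i, Metric.mem_ball_self (by norm_num)⟩
  exact Set.countable_univ_iff.1 this

lemma tsum_ofReal_inner_sq {ι : Type*} (b : HilbertBasis ι ℝ H) (x : H) :
    ∑' i, ENNReal.ofReal (inner ℝ (b i) x ^ 2) = ENNReal.ofReal (‖x‖ ^ 2) := by
  have h := b.hasSum_inner_mul_inner x x
  have h2 : ∀ i, inner ℝ x (b i) * inner ℝ (b i) x = inner ℝ (b i) x ^ 2 := fun i => by
    rw [real_inner_comm, sq]
  simp_rw [h2] at h
  rw [← ENNReal.ofReal_tsum_of_nonneg (fun i => sq_nonneg _) h.summable, h.tsum_eq,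
    real_inner_self_eq_norm_sq]

/-- The adjoint of a Hilbert-Schmidt operator is square summable along any orthonormal basis. -/
lemma IsHilbertSchmidt.summable_adjoint [CompleteSpace G] [CompleteSpace H] {Φ : G →L[ℝ] H}
    (hΦ : IsHilbertSchmidt Φ) {ι : Type*} (b : HilbertBasis ι ℝ H) :
    Summable fun j => ‖ContinuousLinearMap.adjoint Φ (b j)‖ ^ 2 := by
  obtain ⟨w, a, ha⟩ := hΦ
  have hne : ∑' j, ENNReal.ofReal (‖ContinuousLinearMap.adjoint Φ (b j)‖ ^ 2) ≠ ⊤ := by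
    -- By Parseval both sides are the double sum of `⟨Φ a_k, b_j⟩²`; in `[0, ∞]` the order of
    -- summation is free.
    have : ∑' j, ENNReal.ofReal (‖ContinuousLinearMap.adjoint Φ (b j)‖ ^ 2) =
        ∑' k, ENNReal.ofReal (‖Φ (a k)‖ ^ 2) := by
      simp_rw [← tsum_ofReal_inner_sq a, ← tsum_ofReal_inner_sq b]
      rw [ENNReal.tsum_comm]
      simp_rw [ContinuousLinearMap.adjoint_inner_right, real_inner_comm]
    rw [this]
    exact ha.tsum_ofReal_ne_top
  have := ENNReal.summable_toReal hne
  simpa [ENNReal.toReal_ofReal (sq_nonneg _)] using this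

end HilbertSchmidt

/-! ### Increments of cylindrical random variables -/

section Differences

variable {Ω : Type*} [mΩ : MeasurableSpace Ω] {P : Measure Ω}
variable {G : Type*} [NormedAddCommGroup G] [InnerProductSpace ℝ G]

lemma IsCylindricalRV.sub {X X' : G →ₗ[ℝ] (Ω →ₘ[P] ℝ)} (hX : IsCylindricalRV P X)
    (hX' : IsCylindricalRV P X') : IsCylindricalRV P (X - X') := by
  intro g
  have hsub : ∀ g, (fun ω => X g ω - X' g ω) =ᵐ[P] ((X - X') g : Ω → ℝ) := fun g =>
    (AEEqFun.coeFn_sub (X g) (X' g)).symm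
  refine TendstoInMeasure.congr hsub (hsub g) ?_
  have h1 := hX g
  have h2 := hX' g
  rw [tendstoInMeasure_iff_norm] at h1 h2 ⊢
  intro ε hε
  have h3 := (h1 (ε / 2) (half_pos hε)).add (h2 (ε / 2) (half_pos hε))
  rw [add_zero] at h3
  refine tendsto_of_tendsto_of_tendsto_of_le_of_le tendsto_const_nhds h3
    (fun _ => zero_le) fun g' => ?_
  refine (measure_mono fun ω hω => ?_).trans (measure_union_le _ _)
  by_contra hcon
  simp only [Set.mem_union, Set.mem_ofPred_eq, not_or, not_le] at hcon hω
  have : ‖X g' ω - X' g' ω - (X g ω - X' g ω)‖ ≤ ‖X g' ω - X g ω‖ + ‖X' g' ω - X' g ω‖ := by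
    rw [sub_sub_sub_comm]
    exact norm_sub_le _ _
  linarith [hcon.1, hcon.2]

/-- Lets a Radonification of an increment, read on the second factor, serve for the increment of the
copy. -/
lemma secondCopy_sub [IsProbabilityMeasure P] (X X' : G →ₗ[ℝ] (Ω →ₘ[P] ℝ)) :
    secondCopy X - secondCopy X' = secondCopy (X - X') := by
  refine LinearMap.ext fun g => AEEqFun.ext ?_
  have h := measurePreserving_snd (μ := P) (ν := P) |>.quasiMeasurePreserving.ae_eq_comp
    (AEEqFun.coeFn_sub (X g) (X' g))
  filter_upwards [coeFn_secondCopy X g, coeFn_secondCopy X' g, coeFn_secondCopy (X - X') g, h,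
    AEEqFun.coeFn_sub (secondCopy X g) (secondCopy X' g)] with z h1 h2 h3 h4 h5
  rw [h3, LinearMap.sub_apply, LinearMap.sub_apply, h5, Pi.sub_apply, h1, h2]
  exact h4.symm

end Differences

/-! ### Existence and uniqueness of Radonifications -/

section Existence

variable {Ω : Type*} [mΩ : MeasurableSpace Ω] {P : Measure Ω}
variable {G H : Type*} [NormedAddCommGroup G] [InnerProductSpace ℝ G] [CompleteSpace G]
  [NormedAddCommGroup H] [InnerProductSpace ℝ H] [CompleteSpace H]
  [MeasurableSpace H]

/-- A Radonification of `X`, read on the second factor, is one of the copy of `X`. -/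
lemma IsRadonification.comp_snd [IsProbabilityMeasure P] {X : G →ₗ[ℝ] (Ω →ₘ[P] ℝ)}
    {Φ : G →L[ℝ] H} {x : Ω → H} (hx : IsRadonification X Φ x) :
    IsRadonification (secondCopy X) Φ fun z => x z.2 := by
  refine ⟨hx.1.comp measurable_snd, fun h => ?_⟩
  exact ((measurePreserving_snd (μ := P) (ν := P)).quasiMeasurePreserving.ae_eq_comp
    (hx.2 h)).trans (coeFn_secondCopy X _).symm

/-- Radonifications are almost surely unique. -/
lemma IsRadonification.ae_eq [SecondCountableTopology H] {X : G →ₗ[ℝ] (Ω →ₘ[P] ℝ)}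
    {Φ : G →L[ℝ] H} {Y Y' : Ω → H}
    (hY : IsRadonification X Φ Y) (hY' : IsRadonification X Φ Y') : Y =ᵐ[P] Y' := by
  have h : (fun ω => Y ω - Y' ω) =ᵐ[P] 0 := by
    refine ae_eq_zero_of_forall_inner (𝕜 := ℝ) fun c => ?_
    filter_upwards [hY.2 c, hY'.2 c] with ω h1 h2
    rw [real_inner_comm, inner_sub_left, h1, h2, sub_self]
    rfl
  filter_upwards [h] with ω hω
  exact sub_eq_zero.1 hω

/-- A Hilbert-Schmidt operator radonifies a cylindrical random variable, with a version measurable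
with respect to any σ-algebra to which the cylindrical random variable is adapted. -/
lemma IsCylindricalRV.exists_isRadonification {Ω : Type*} {m : MeasurableSpace Ω}
    [mΩ : MeasurableSpace Ω] {P : Measure Ω} [IsProbabilityMeasure P]
    [SecondCountableTopology H] [BorelSpace H]
    {X : G →ₗ[ℝ] (Ω →ₘ[P] ℝ)} (hX : IsCylindricalRV P X) {Φ : G →L[ℝ] H}
    (hΦ : IsHilbertSchmidt Φ) (hm : m ≤ mΩ)
    (hXm : ∀ g, AEStronglyMeasurable[m] (X g) P) :
    ∃ Y : Ω → H, Measurable[m] Y ∧ IsRadonification X Φ Y := by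
  obtain ⟨w, b, -⟩ := exists_hilbertBasis ℝ H
  have : Countable w := b.orthonormal.countable_index
  -- Taking `m`-measurable representatives makes the convergence set and the sum `m`-measurable, not
  -- merely up to null sets.
  let a : w → Ω → ℝ := fun j => (hXm (ContinuousLinearMap.adjoint Φ (b j))).mk _
  have ham : ∀ j, Measurable[m] (a j) := fun j =>
    (hXm (ContinuousLinearMap.adjoint Φ (b j))).stronglyMeasurable_mk.measurable
  have haX : ∀ j, a j =ᵐ[P] X (ContinuousLinearMap.adjoint Φ (b j)) := fun j =>
    (hXm (ContinuousLinearMap.adjoint Φ (b j))).ae_eq_mk.symm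
  let S : Set Ω := {ω | Summable fun j => a j ω ^ 2}
  have hS : MeasurableSet[m] S := @measurableSet_summable_sq Ω m w _ a ham
  have hSae : ∀ᵐ ω ∂P, ω ∈ S :=
    hX.ae_summable_sq (hΦ.summable_adjoint b) (fun j => (ham j).mono hm le_rfl) haX
  have hsummable : ∀ ω ∈ S, Summable fun j => a j ω • b j := by
    intro ω hω
    have hmem : Memℓp (fun j => a j ω) 2 := by
      refine memℓp_gen ?_
      have hω' : Summable fun j => a j ω ^ 2 := hω
      simpa using hω'
    exact (b.hasSum_repr_symm ⟨_, hmem⟩).summable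
  let Y : Ω → H := S.indicator fun ω => ∑' j, a j ω • b j
  have hYm : Measurable[m] Y := by
    refine @measurable_of_tendsto_metrizable' Ω H m _ _ _ _ (Finset w)
      (fun s => S.indicator fun ω => ∑ j ∈ s, a j ω • b j) Y atTop _ _ ?_ ?_
    · intro s
      refine Measurable.indicator ?_ hS
      exact Finset.measurable_sum s fun j _ => (ham j).smul_const (b j)
    · rw [tendsto_pi_nhds]
      intro ω
      by_cases hω : ω ∈ S
      · simp only [Y, Set.indicator_of_mem hω]
        exact (hsummable ω hω).hasSum
      · simp [Y, Set.indicator_of_notMem hω]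
  refine ⟨Y, hYm, hYm.mono hm le_rfl, fun h => ?_⟩
  -- On finite partial sums of the expansion of `h` the identity is linearity of `X`. Continuity in
  -- probability passes to the limit, almost surely along a sequence `ns` of finite sets.
  have hconv : Tendsto (fun s : Finset w => ContinuousLinearMap.adjoint Φ
      (∑ j ∈ s, inner ℝ (b j) h • b j)) atTop (𝓝 (ContinuousLinearMap.adjoint Φ h)) := by
    refine ((ContinuousLinearMap.adjoint Φ).continuous.tendsto h).comp ?_
    have := b.hasSum_repr h
    simp_rw [b.repr_apply_apply] at this
    exact this
  obtain ⟨ns, hns, hlim⟩ := ((hX _).comp hconv).exists_seq_tendsto_ae'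
  have heq : ∀ᵐ ω ∂P, ∀ i, X (ContinuousLinearMap.adjoint Φ
      (∑ j ∈ ns i, inner ℝ (b j) h • b j)) ω = ∑ j ∈ ns i, inner ℝ (b j) h * a j ω := by
    refine ae_all_iff.2 fun i => ?_
    simp_rw [map_sum (ContinuousLinearMap.adjoint Φ), map_smul]
    filter_upwards [coeFn_map_sum_smul X (ns i) (fun j => inner ℝ (b j) h)
      fun j => ContinuousLinearMap.adjoint Φ (b j), ae_all_iff.2 haX] with ω h1 h2
    rw [h1]
    simp_rw [h2]
  filter_upwards [hSae, hlim, heq] with ω hω h1 h2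
  have h3 : HasSum (fun j => inner ℝ (b j) h * a j ω) (inner ℝ (Y ω) h) := by
    have h4 := (hsummable ω hω).hasSum
    have h5 := h4.mapL (innerSL ℝ h)
    simp only [Y, Set.indicator_of_mem hω]
    rw [real_inner_comm]
    convert! h5 using 2 with j
    rw [innerSL_apply_apply, real_inner_smul_right, real_inner_comm, mul_comm]
  refine tendsto_nhds_unique (Tendsto.comp h3 hns) ?_
  simp only [Function.comp_def, h2] at h1
  exact h1

end Existence

/-! ### Joint laws and conditional laws -/

section JointLaws

variable {Ω : Type*} [mΩ : MeasurableSpace Ω] {P : Measure Ω} [IsProbabilityMeasure P]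
variable {H : Type*} [NormedAddCommGroup H] [SecondCountableTopology H] [MeasurableSpace H]
  [BorelSpace H]

/-- The conditional law of `X` given `m` depends only on the joint law of `X` and `m`. -/
lemma condLaw_congr_of_map_eq {Ω : Type*} {m : MeasurableSpace Ω} [mΩ : MeasurableSpace Ω]
    {P : Measure Ω} [CompleteSpace H] [IsProbabilityMeasure P] {X Y : Ω → H}
    (h : @Measure.map Ω (Ω × H) mΩ (m.prod inferInstance) (fun ω => (ω, X ω)) P =
      @Measure.map Ω (Ω × H) mΩ (m.prod inferInstance) (fun ω => (ω, Y ω)) P) :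
    condLaw P m X = condLaw P m Y := by
  have : @condDistrib Ω Ω H _ _ _ mΩ m X id P _ = @condDistrib Ω Ω H _ _ _ mΩ m Y id P _ := by
    -- `condDistrib` is by definition the disintegration kernel of the joint law.
    simp only [condDistrib, id]
    congr 1
  funext ω
  simp only [condLaw, this]

/-- If `V` is independent of `f`, then weighting its components by functions of `f` yields the same
joint law with `f` on both factors, whether `V` is read on the first or on the second factor. -/
lemma map_sum_indicator_fst_eq_snd {α κ : Type*} [MeasurableSpace α] [Fintype κ] {f : Ω → α}
    (hf : Measurable f) {V : κ → Ω → H} (hV : ∀ k, Measurable (V k))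
    (hind : IndepFun f (fun ω k => V k ω) P) {B : κ → Set α} (hB : ∀ k, MeasurableSet (B k)) :
    (P.prod P).map (fun z => ((f z.1, f z.2),
        ∑ k, (B k).indicator (fun _ => V k z.1) (f z.1))) =
      (P.prod P).map (fun z => ((f z.1, f z.2),
        ∑ k, (B k).indicator (fun _ => V k z.2) (f z.1))) := by
  have hVm : Measurable fun ω k => V k ω := measurable_pi_lambda _ hV
  -- The weights look at the first past coordinate in both versions, so one map pushes forward both
  -- laws.
  let Ψ : (α × α) × (κ → H) → (α × α) × H := fun p =>
    (p.1, ∑ k, (B k).indicator (fun _ => p.2 k) p.1.1)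
  have hΨ : Measurable Ψ := by
    refine measurable_fst.prodMk (Finset.measurable_sum _ fun k _ => ?_)
    have : (fun p : (α × α) × (κ → H) => (B k).indicator (fun _ => p.2 k) p.1.1) =
        ((fun p : (α × α) × (κ → H) => p.1.1) ⁻¹' B k).indicator fun p => p.2 k := by
      ext p
      by_cases hp : p.1.1 ∈ B k
      · rw [Set.indicator_of_mem hp, Set.indicator_of_mem (by exact hp)]
      · rw [Set.indicator_of_notMem hp, Set.indicator_of_notMem (by exact hp)]
    rw [this]
    refine Measurable.indicator (by fun_prop) ?_
    exact (measurable_fst.comp measurable_fst) (hB k)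
  have h1 := congrArg (Measure.map Ψ) (map_prod_fst_eq_map_prod_snd hf hVm hind)
  rw [Measure.map_map hΨ (by fun_prop), Measure.map_map hΨ (by fun_prop)] at h1
  exact h1

end JointLaws

/-! ### Independence of Radonified increments from the past -/

section Tangent

variable {Ω : Type*} [mΩ : MeasurableSpace Ω] {P : Measure Ω} [IsProbabilityMeasure P]
variable {G H : Type*} [NormedAddCommGroup G] [InnerProductSpace ℝ G] [CompleteSpace G]
  [NormedAddCommGroup H] [InnerProductSpace ℝ H] [CompleteSpace H]
  [SecondCountableTopology H] [MeasurableSpace H] [BorelSpace H]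

/-- Radonifications of a cylindrical random variable adapted to `m` are jointly independent of any
σ-algebra independent of `m`. -/
lemma IsCylindricalRV.indep_radonification {Ω : Type*} {m m' : MeasurableSpace Ω}
    [mΩ : MeasurableSpace Ω] {P : Measure Ω} [IsProbabilityMeasure P] {X : G →ₗ[ℝ] (Ω →ₘ[P] ℝ)}
    (hX : IsCylindricalRV P X) (hm : m ≤ mΩ) (hXm : ∀ g, AEStronglyMeasurable[m] (X g) P)
    (hind : Indep m m' P) {κ : Type*} [Countable κ] {Φ : κ → (G →L[ℝ] H)}
    (hΦ : ∀ k, IsHilbertSchmidt (Φ k)) {x : κ → Ω → H}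
    (hx : ∀ k, IsRadonification X (Φ k) (x k)) :
    Indep (MeasurableSpace.comap (fun ω k => x k ω) inferInstance) m' P := by
  -- The given versions need not be `m`-measurable; almost surely equal ones that are carry the
  -- independence.
  choose x' hx'm hx' using fun k => hX.exists_isRadonification (hΦ k) hm hXm
  have h1 : Measurable[m] fun ω k => x' k ω :=
    @measurable_pi_lambda Ω κ (fun _ => H) m _ _ hx'm
  have h2 := indepFun_id_right_iff.2 (indep_of_indep_of_le_left hind h1.comap_le)
  refine indepFun_id_right_iff.1 (h2.congr ?_ .rfl)
  filter_upwards [ae_all_iff.2 fun k => (hx' k).ae_eq (hx k)] with ω hω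
  exact funext hω

/-- The Radonified increments after time `s` are jointly independent of `𝓕 s`. -/
lemma IsLevyFiltration.indep_radonification {L : ℝ≥0 → G →ₗ[ℝ] (Ω →ₘ[P] ℝ)}
    (hL : IsCylindricalLevyProcess P L) {𝓕 : Filtration ℝ≥0 mΩ} (h𝓕 : IsLevyFiltration P L 𝓕)
    {s t : ℝ≥0} (hst : s ≤ t) {κ : Type*} [Countable κ] {Φ : κ → (G →L[ℝ] H)}
    (hΦ : ∀ k, IsHilbertSchmidt (Φ k)) {x : κ → Ω → H}
    (hx : ∀ k, IsRadonification (L t - L s) (Φ k) (x k)) :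
    Indep (MeasurableSpace.comap (fun ω k => x k ω) inferInstance) (𝓕 s) P := by
  let D : G → Ω → ℝ := fun g ω => L t g ω - L s g ω
  have hD : ∀ g, Measurable (D g) := fun g => (L t g).measurable.sub (L s g).measurable
  refine ((hL.cylindrical t).sub (hL.cylindrical s)).indep_radonification
    (m := MeasurableSpace.comap (fun ω g => D g ω) inferInstance)
    (measurable_pi_lambda _ hD).comap_le (fun g => ?_)
    (indep_comap_pi_of_finite hD (𝓕.le s) fun n g => h𝓕.indep s t hst n g) hΦ hx
  have h1 := (measurable_pi_apply g).comp (comap_measurable fun ω g => D g ω)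
  exact ⟨D g, h1.stronglyMeasurable, AEEqFun.coeFn_sub (L t g) (L s g)⟩

end Tangent

end CylLevy

/-! ### The decoupled tangent sequence -/

open CylLevy
theorem proposition6p3
    {Ω : Type*} [mΩ : MeasurableSpace Ω] (P : Measure Ω) [IsProbabilityMeasure P]
    {G : Type*} [NormedAddCommGroup G] [InnerProductSpace ℝ G] [CompleteSpace G]
    [SecondCountableTopology G]
    {H : Type*} [NormedAddCommGroup H] [InnerProductSpace ℝ H] [CompleteSpace H]
    [SecondCountableTopology H] [MeasurableSpace H] [BorelSpace H]
    (L : ℝ≥0 → G →ₗ[ℝ] (Ω →ₘ[P] ℝ)) (hL : IsCylindricalLevyProcess P L) :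
    -- the copy is a cylindrical Lévy process
    IsCylindricalLevyProcess (P.prod P) (fun t => secondCopy (L t)) ∧
    -- the generated filtration is one of the filtrations considered below
    IsLevyFiltration P L (generatedFiltration L) ∧
    ∀ (𝓕 : Filtration ℝ≥0 mΩ), IsLevyFiltration P L 𝓕 →
    ∀ (N : ℕ) (T : ℝ≥0) (t : Fin (N + 1) → ℝ≥0) (ht : Monotone t),
      t 0 = 0 → t (Fin.last N) = T →
    ∀ (M : Fin N → ℕ) (Φ : (n : Fin N) → Fin (M n) → (G →L[ℝ] H))
      (A : (n : Fin N) → Fin (M n) → Set Ω),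
      (∀ n k, IsHilbertSchmidt (Φ n k)) →
      (∀ n k, MeasurableSet[𝓕 (t n.castSucc)] (A n k)) →
    -- Radonified increments of `L` and of its copy exist
    (∀ n k, ∃ x : Ω → H, Measurable[𝓕 (t n.succ)] x ∧
      IsRadonification (L (t n.succ) - L (t n.castSucc)) (Φ n k) x) ∧
    (∀ n k, ∃ y : Ω × Ω → H, Measurable[(𝓕 (t n.succ)).prod (𝓕 (t n.succ))] y ∧
      IsRadonification (secondCopy (L (t n.succ)) - secondCopy (L (t n.castSucc))) (Φ n k) y ∧
      ∀ ω, IsRadonification (L (t n.succ) - L (t n.castSucc)) (Φ n k) fun ω' => y (ω, ω')) ∧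
    -- and, for all choices of them, those of the copy are decoupled tangent to those of `L`
    ∀ (x : (n : Fin N) → Fin (M n) → Ω → H) (y : (n : Fin N) → Fin (M n) → Ω × Ω → H),
      (∀ n k, Measurable[𝓕 (t n.succ)] (x n k) ∧
        IsRadonification (L (t n.succ) - L (t n.castSucc)) (Φ n k) (x n k)) →
      (∀ n k, Measurable[(𝓕 (t n.succ)).prod (𝓕 (t n.succ))] (y n k) ∧
        IsRadonification (secondCopy (L (t n.succ)) - secondCopy (L (t n.castSucc)))
          (Φ n k) (y n k) ∧
        ∀ ω, IsRadonification (L (t n.succ) - L (t n.castSucc)) (Φ n k)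
          fun ω' => y n k (ω, ω')) →
      IsDecoupledTangentSequence P (sampledFiltration 𝓕 t ht) P (sampledFiltration 𝓕 t ht)
        (fun n ω => ∑ k, (A n k).indicator (x n k) ω)
        (fun n z => ∑ k, (Prod.fst ⁻¹' A n k).indicator (y n k) z) := by
  refine ⟨hL.secondCopy, hL.isLevyFiltration_generatedFiltration, ?_⟩
  intro 𝓕 h𝓕 N T t ht _ _ M Φ A hΦ hA
  have hle : ∀ n : Fin N, t n.castSucc ≤ t n.succ := fun n => ht (Fin.castSucc_lt_succ).le
  have hA' : ∀ n k, MeasurableSet[𝓕 (t n.succ)] (A n k) := fun n k =>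
    𝓕.mono (hle n) _ (hA n k)
  have hex : ∀ n k, ∃ x : Ω → H, Measurable[𝓕 (t n.succ)] x ∧
      IsRadonification (L (t n.succ) - L (t n.castSucc)) (Φ n k) x := fun n k => by
    refine ((hL.cylindrical _).sub (hL.cylindrical _)).exists_isRadonification (hΦ n k)
      (𝓕.le _) fun g => ?_
    exact ((h𝓕.adapted _ g).sub ((h𝓕.adapted _ g).mono (𝓕.mono (hle n)))).congr
      (AEEqFun.coeFn_sub (L (t n.succ) g) (L (t n.castSucc) g)).symm
  refine ⟨hex, fun n k => ?_, fun x y hx hy => ?_⟩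
  · obtain ⟨x, hxm, hx⟩ := hex n k
    -- A function of `ω'` alone: every section is the same Radonification on `Ω`.
    refine ⟨fun z => x z.2, ?_, ?_, fun _ => hx⟩
    · exact hxm.comp (@measurable_snd Ω Ω (𝓕 (t n.succ)) (𝓕 (t n.succ)))
    · rw [secondCopy_sub]
      exact hx.comp_snd
  have hind : ∀ n, Indep (MeasurableSpace.comap (fun ω k => x n k ω) inferInstance)
      (𝓕 (t n.castSucc)) P := fun n =>
    h𝓕.indep_radonification hL (hle n) (hΦ n) fun k => (hx n k).2
  -- Independence is claimed for every `ω`, which needs this sectionwise comparison; for tangency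
  -- the `P ⊗ P`-almost sure one below suffices.
  have hsec : ∀ n k ω, (fun ω' => y n k (ω, ω')) =ᵐ[P] x n k := fun n k ω =>
    ((hy n k).2.2 ω).ae_eq (hx n k).2
  have hprod : ∀ n k, y n k =ᵐ[P.prod P] fun z => x n k z.2 := fun n k => by
    have h := (hy n k).2.1
    rw [secondCopy_sub] at h
    exact h.ae_eq (hx n k).2.comp_snd
  refine ⟨fun n => ?_, fun n => ?_, fun ω => ?_, fun n => ?_⟩
  · exact Finset.measurable_sum _ fun k _ => (hx n k).1.indicator (hA' n k)
  · refine Finset.measurable_sum _ fun k _ => (hy n k).1.indicator ?_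
    exact (@measurable_fst Ω Ω (𝓕 (t n.succ)) (𝓕 (t n.succ))) (hA' n k)
  · let φ : (n : Fin N) → (Fin (M n) → H) → H := fun n v =>
      ∑ k, (A n k).indicator (fun _ => v k) ω
    have hφ : ∀ n, Measurable (φ n) := fun n => by
      refine Finset.measurable_sum _ fun k _ => ?_
      by_cases hω : ω ∈ A n k
      · simp only [Set.indicator_of_mem hω]; fun_prop
      · simp only [Set.indicator_of_notMem hω]; fun_prop
    have hiInd : iIndepFun (fun n ω' => φ n fun k => x n k ω') P := by
      refine iIndepFun_of_indep_past (sampledFiltration 𝓕 t ht) (fun n => ?_) fun n => ?_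
      · have h1 : Measurable[𝓕 (t n.succ)] fun ω' k => x n k ω' :=
          @measurable_pi_lambda Ω (Fin (M n)) (fun _ => H) (𝓕 (t n.succ)) _ _ fun k => (hx n k).1
        exact (hφ n).comp h1
      · refine indep_of_indep_of_le_left (hind n) ?_
        exact ((hφ n).comp (comap_measurable fun ω k => x n k ω)).comap_le
    refine hiInd.congr fun n => ?_
    filter_upwards [ae_all_iff.2 fun k => hsec n k ω] with ω' hω'
    refine Finset.sum_congr rfl fun k _ => ?_
    by_cases hω : ω ∈ A n k
    · rw [Set.indicator_of_mem hω, Set.indicator_of_mem (by exact hω), hω']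
    · rw [Set.indicator_of_notMem hω, Set.indicator_of_notMem (by exact hω)]
  · refine ae_of_all _ fun z => congrFun (condLaw_congr_of_map_eq ?_) z
    -- With the identity into the past σ-algebra as `f`, the equality of laws is the one that
    -- determines the conditional laws.
    have hid : @Measurable Ω Ω mΩ (𝓕 (t n.castSucc)) id := fun S hS => 𝓕.le _ S hS
    have hIF : @IndepFun Ω Ω (Fin (M n) → H) mΩ (𝓕 (t n.castSucc)) _ id
        (fun ω k => x n k ω) P := (indepFun_id_right_iff.2 (hind n)).symm
    have hmap := @map_sum_indicator_fst_eq_snd Ω mΩ P _ H _ _ _ _ Ω (Fin (M n))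
      (𝓕 (t n.castSucc)) _ id hid (x n) (fun k => (hx n k).2.1) hIF (A n) (hA n)
    refine Eq.trans hmap (Measure.map_congr ?_)
    filter_upwards [ae_all_iff.2 (hprod n)] with z hz
    refine congrArg (Prod.mk z) (Finset.sum_congr rfl fun k _ => ?_)
    by_cases hω : z.1 ∈ A n k
    · rw [Set.indicator_of_mem (by exact hω), Set.indicator_of_mem (by exact hω), hz]
    · rw [Set.indicator_of_notMem (by exact hω), Set.indicator_of_notMem (by exact hω)]
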